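/- Let $\mathfrak g$ be a finite dimensional real Lie algebra and let $M$ be a smooth ($C^\infty$, finite dimensional, Hausdorff) manifold with an action of $\mathfrak g$, i.e. a homomorphism of Lie algebras $\zeta:\mathfrak g\to\mathfrak X(M)$, $X\mapsto\zeta_X$, into the Lie algebra of smooth vector fields on $M$. For $x\in M$ let $\mathfrak g(x)=\{\zeta_X(x):X\in\mathfrak g\}\subseteq T_xM$ be the vertical space and $\mathfrak g_x=\{X\in\mathfrak g:\zeta_X(x)=0\}$ the isotropy subalgebra. A *principal connection* is a smooth field of endomorphisms $\Phi\in\Omega^1(M;TM)$ such that each $\Phi_x:T_xM\to T_xM$ is a projection onto $\mathfrak g(x)$ and such that $\mathcal L_{\zeta_X}\Phi=[\zeta_X,\Phi]=0$ for all $X\in\mathfrak g$. Its horizontal space at $x$ is $\ker\Phi_x$, its curvature is $R=\tfrac12[\Phi,\Phi]\in\Omega^2(M;TM)$ (Frölicher–Nijenhuis bracket), and it is *flat* if $R=0$. The *isotropy representation* of $\mathfrak g_x$ on $T_xM$ is $\rho_x(X)v=[\zeta_X,V](x)$, where $V$ is any vector field, smooth near $x$, with $V(x)=v$. The action is *locally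 trivial* if there are a connected smooth manifold $S$ with a transitive action $\zeta^S$ of $\mathfrak g$ (that is, $X\mapsto\zeta^S_X(s)\in T_sS$ is onto for every $s\in S$) and a submersion $p:M\to N$ onto a smooth manifold $N$ such that each point of $N$ has an open neighbourhood $U$ with a diffeomorphism $\varphi:p^{-1}(U)\to U\times S$ satisfying $\mathrm{pr}_1\circ\varphi=p$ and $T\varphi\circ\zeta_X=(0\times\zeta^S_X)\circ\varphi$ on $p^{-1}(U)$ for all $X\in\mathfrak g$. A locally trivial action is *asystatic* if $N_{\mathfrak g}(\mathfrak g_x)=\mathfrak g_x$ for every $x\in M$, where $N_{\mathfrak g}$ denotes the normalizer in $\mathfrak g$. **Proposition.** Let the action of $\mathfrak g$ on $M$ be locally trivial and asystatic. Then there is exactly one principal connection $\Phi$ on $M$. This connection is flat, and for every $x\in M$ its horizontal space is $$\ker\Phi_x=\{v\in T_xM:\ \rho_x(X)v=0\ \text{ for all } X\in\mathfrak g_x\}.$$ -/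

import Mathlib

open Bundle VectorField Function Set
open scoped Manifold ContDiff

universe v w

section LieAlgebraActions

variable (𝔤 : Type*) [LieRing 𝔤] [LieAlgebra ℝ 𝔤]
  (E : Type*) [NormedAddCommGroup E] [NormedSpace ℝ E]
  (M : Type*) [TopologicalSpace M] [ChartedSpace E M] [IsManifold 𝓘(ℝ, E) ∞ M]

/-- An action of the Lie algebra `𝔤` on the smooth manifold `M` (modelled on `E`): a homomorphism
of Lie algebras from `𝔤` to the Lie algebra of smooth vector fields on `M`. The vector field
`ζ.field X` is the fundamental vector field of `X`. -/
structure LieAlgebraAction where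
  /-- The linear map assigning to `X` its fundamental vector field. -/
  field : 𝔤 →ₗ[ℝ] (Π x : M, TangentSpace 𝓘(ℝ, E) x)
  smooth : ∀ X : 𝔤, ContMDiff 𝓘(ℝ, E) 𝓘(ℝ, E).tangent ∞
    (fun x : M => (⟨x, field X x⟩ : TangentBundle 𝓘(ℝ, E) M))
  field_lie : ∀ (X Y : 𝔤) (x : M),
    field ⁅X, Y⁆ x = mlieBracket 𝓘(ℝ, E) (field X) (field Y) x

end LieAlgebraActions

namespace LieAlgebraAction

variable {𝔤 : Type*} [LieRing 𝔤] [LieAlgebra ℝ 𝔤]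
  {E : Type*} [NormedAddCommGroup E] [NormedSpace ℝ E]
  {M : Type*} [TopologicalSpace M] [ChartedSpace E M] [IsManifold 𝓘(ℝ, E) ∞ M]

/-- The evaluation `ζ_x : 𝔤 → T_x M`. -/
noncomputable def evalAt (ζ : LieAlgebraAction 𝔤 E M) (x : M) : 𝔤 →ₗ[ℝ] TangentSpace 𝓘(ℝ, E) x :=
  (LinearMap.proj x).comp ζ.field

@[simp]
theorem evalAt_apply (ζ : LieAlgebraAction 𝔤 E M) (x : M) (X : 𝔤) :
    ζ.evalAt x X = ζ.field X x := rfl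

/-- The vertical space `𝔤(x) = {ζ_X(x) : X ∈ 𝔤} ⊆ T_x M`. -/
noncomputable def vertical (ζ : LieAlgebraAction 𝔤 E M) (x : M) : Submodule ℝ (TangentSpace 𝓘(ℝ, E) x) :=
  LinearMap.range (ζ.evalAt x)

/-- The isotropy subalgebra `𝔤_x = {X ∈ 𝔤 : ζ_X(x) = 0}`. -/
noncomputable def isotropy (ζ : LieAlgebraAction 𝔤 E M) (x : M) : LieSubalgebra ℝ 𝔤 where
  toSubmodule := LinearMap.ker (ζ.evalAt x)
  lie_mem' := by
    intro X Y hX hY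
    have hX' : ζ.field X x = 0 := hX
    have hY' : ζ.field Y x = 0 := hY
    change ζ.field ⁅X, Y⁆ x = 0
    rw [ζ.field_lie, ← mlieBracketWithin_univ]
    exact mlieBracketWithin_eq_zero_of_eq_zero hX' hY'

theorem mem_isotropy (ζ : LieAlgebraAction 𝔤 E M) (x : M) (X : 𝔤) :
    X ∈ ζ.isotropy x ↔ ζ.field X x = 0 := Iff.rfl

/-- The action is transitive: every `ζ_x : 𝔤 → T_x M` is onto. -/
def IsTransitive (ζ : LieAlgebraAction 𝔤 E M) : Prop :=
  ∀ x : M, Surjective (ζ.evalAt x)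

/-- The action is asystatic: every isotropy subalgebra is equal to its normalizer in `𝔤`. -/
def IsAsystatic (ζ : LieAlgebraAction 𝔤 E M) : Prop :=
  ∀ x : M, (ζ.isotropy x).normalizer = ζ.isotropy x

/-! ### Locally trivial actions -/

/-- `φ` is a bundle chart over the open set `U ⊆ N` for the map `p : M → N`, with standard fibre
the `𝔤`-manifold `S`: a diffeomorphism `φ : p⁻¹(U) → U × S` over `U` which is `𝔤`-equivariant,
i.e. `ζ^M_X` and `0 × ζ^S_X` are `φ`-related for every `X`. -/
structure IsBundleChart (ζ : LieAlgebraAction 𝔤 E M)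
    {n k : ℕ}
    {N : Type*} [TopologicalSpace N] [ChartedSpace (EuclideanSpace ℝ (Fin n)) N]
    {S : Type*} [TopologicalSpace S] [ChartedSpace (EuclideanSpace ℝ (Fin k)) S]
    [IsManifold (𝓡 k) ∞ S]
    (η : LieAlgebraAction 𝔤 (EuclideanSpace ℝ (Fin k)) S)
    (p : M → N) (U : Set N)
    (φ : PartialDiffeomorph 𝓘(ℝ, E) ((𝓡 n).prod (𝓡 k)) M (N × S) ∞) : Prop where
  isOpen : IsOpen U
  source_eq : φ.source = p ⁻¹' U
  target_eq : φ.target = U ×ˢ (univ : Set S)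
  fst_eq : ∀ y ∈ p ⁻¹' U, (φ y).1 = p y
  equivariant : ∀ (X : 𝔤), ∀ y ∈ p ⁻¹' U,
    mfderiv 𝓘(ℝ, E) ((𝓡 n).prod (𝓡 k)) φ y (ζ.field X y) =
      ((0, η.field X (φ y).2) : EuclideanSpace ℝ (Fin n) × EuclideanSpace ℝ (Fin k))

/-- The action is locally trivial: there are a connected manifold `S` with a transitive action of
`𝔤` (the standard fibre) and a submersion `p` of `M` onto a manifold `N`, such that every point of
`N` has an open neighbourhood over which there is a bundle chart.
(Manifolds are Hausdorff; no countability is demanded here, but it is inherited from `M`, because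
`N` is an open continuous image of `M` and `S` is diffeomorphic to the fibres of `p`.) -/
def IsLocallyTrivial (ζ : LieAlgebraAction 𝔤 E M) : Prop :=
  ∃ (n k : ℕ)
    (N : Type v) (_ : TopologicalSpace N) (_ : T2Space N)
    (_ : ChartedSpace (EuclideanSpace ℝ (Fin n)) N) (_ : IsManifold (𝓡 n) ∞ N)
    (S : Type w) (_ : TopologicalSpace S) (_ : T2Space S) (_ : ConnectedSpace S)
    (_ : ChartedSpace (EuclideanSpace ℝ (Fin k)) S) (_ : IsManifold (𝓡 k) ∞ S)
    (η : LieAlgebraAction 𝔤 (EuclideanSpace ℝ (Fin k)) S) (p : M → N),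
    η.IsTransitive ∧
    Manifold.IsSubmersion 𝓘(ℝ, E) (𝓡 n) ∞ p ∧ Surjective p ∧
    ∀ z : N, ∃ U : Set N, z ∈ U ∧
      ∃ φ : PartialDiffeomorph 𝓘(ℝ, E) ((𝓡 n).prod (𝓡 k)) M (N × S) ∞,
        ζ.IsBundleChart η p U φ

end LieAlgebraAction

/-! ### Fields of endomorphisms of the tangent bundle -/

section EndomorphismFields

variable {E : Type*} [NormedAddCommGroup E] [NormedSpace ℝ E]
  {M : Type*} [TopologicalSpace M] [ChartedSpace E M] [IsManifold 𝓘(ℝ, E) ∞ M]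

/-- The vector field `V` is smooth at `x`. -/
def SmoothFieldAt (V : Π x : M, TangentSpace 𝓘(ℝ, E) x) (x : M) : Prop :=
  ContMDiffAt 𝓘(ℝ, E) 𝓘(ℝ, E).tangent ∞
    (fun y : M => (⟨y, V y⟩ : TangentBundle 𝓘(ℝ, E) M)) x

/-- The field of endomorphisms `K` is smooth, i.e. it is a smooth vector bundle homomorphism
`TM → TM` over the identity, i.e. a tangent bundle valued 1-form `K ∈ Ω¹(M; TM)`. -/
def SmoothEndo (K : Π x : M, TangentSpace 𝓘(ℝ, E) x →L[ℝ] TangentSpace 𝓘(ℝ, E) x) : Prop :=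
  ContMDiff 𝓘(ℝ, E).tangent 𝓘(ℝ, E).tangent ∞
    (fun a : TangentBundle 𝓘(ℝ, E) M => (⟨a.proj, K a.proj a.2⟩ : TangentBundle 𝓘(ℝ, E) M))

/-- The Lie derivative `ℒ_Z K = [Z, K]` of the field of endomorphisms `K` along the vector field
`Z`, evaluated on the vector field `V` at `x`: `[Z, K V] - K [Z, V]`. -/
noncomputable def lieDerivEndo (Z : Π x : M, TangentSpace 𝓘(ℝ, E) x)
    (K : Π x : M, TangentSpace 𝓘(ℝ, E) x →L[ℝ] TangentSpace 𝓘(ℝ, E) x)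
    (V : Π x : M, TangentSpace 𝓘(ℝ, E) x) (x : M) : TangentSpace 𝓘(ℝ, E) x :=
  mlieBracket 𝓘(ℝ, E) Z (fun y => K y (V y)) x - K x (mlieBracket 𝓘(ℝ, E) Z V x)

/-- The Frölicher-Nijenhuis bracket `[K, L] ∈ Ω²(M; TM)` of two tangent bundle valued 1-forms,
evaluated on the vector fields `V`, `W` at `x`. -/
noncomputable def frolicherNijenhuis
    (K L : Π x : M, TangentSpace 𝓘(ℝ, E) x →L[ℝ] TangentSpace 𝓘(ℝ, E) x)
    (V W : Π x : M, TangentSpace 𝓘(ℝ, E) x) (x : M) : TangentSpace 𝓘(ℝ, E) x :=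
  (mlieBracket 𝓘(ℝ, E) (fun y => K y (V y)) (fun y => L y (W y)) x
      - mlieBracket 𝓘(ℝ, E) (fun y => K y (W y)) (fun y => L y (V y)) x)
    - L x (mlieBracket 𝓘(ℝ, E) (fun y => K y (V y)) W x
        - mlieBracket 𝓘(ℝ, E) (fun y => K y (W y)) V x)
    - K x (mlieBracket 𝓘(ℝ, E) (fun y => L y (V y)) W x
        - mlieBracket 𝓘(ℝ, E) (fun y => L y (W y)) V x)
    + L x (K x (mlieBracket 𝓘(ℝ, E) V W x))
    + K x (L x (mlieBracket 𝓘(ℝ, E) V W x))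

/-- The curvature `R = ½ [Φ, Φ]` of a connection, evaluated on vector fields. -/
noncomputable def connectionCurvature
    (Φ : Π x : M, TangentSpace 𝓘(ℝ, E) x →L[ℝ] TangentSpace 𝓘(ℝ, E) x)
    (V W : Π x : M, TangentSpace 𝓘(ℝ, E) x) (x : M) : TangentSpace 𝓘(ℝ, E) x :=
  (1 / 2 : ℝ) • frolicherNijenhuis Φ Φ V W x

/-- The connection `Φ` is flat: its curvature vanishes. -/
def IsFlatConnection
    (Φ : Π x : M, TangentSpace 𝓘(ℝ, E) x →L[ℝ] TangentSpace 𝓘(ℝ, E) x) : Prop :=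
  ∀ (x : M) (V W : Π x : M, TangentSpace 𝓘(ℝ, E) x), SmoothFieldAt V x → SmoothFieldAt W x →
    connectionCurvature Φ V W x = 0

end EndomorphismFields

namespace LieAlgebraAction

variable {𝔤 : Type*} [LieRing 𝔤] [LieAlgebra ℝ 𝔤]
  {E : Type*} [NormedAddCommGroup E] [NormedSpace ℝ E]
  {M : Type*} [TopologicalSpace M] [ChartedSpace E M] [IsManifold 𝓘(ℝ, E) ∞ M]

/-! ### Principal connections -/

/-- `Φ ∈ Ω¹(M; TM)` is a connection for the action: every `Φ_x` is a projection of `T_x M` onto the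
vertical space `𝔤(x)`. -/
structure IsConnection (ζ : LieAlgebraAction 𝔤 E M)
    (Φ : Π x : M, TangentSpace 𝓘(ℝ, E) x →L[ℝ] TangentSpace 𝓘(ℝ, E) x) : Prop where
  smooth : SmoothEndo Φ
  isProj : ∀ x : M, LinearMap.IsProj (ζ.vertical x) (Φ x : _ →ₗ[ℝ] TangentSpace 𝓘(ℝ, E) x)

/-- The connection `Φ` is principal: it is `𝔤`-equivariant, i.e. the Lie derivative of `Φ` along
every fundamental vector field vanishes. (The Lie derivative is a tensor field, and it is tested at
`x` on the vector fields that are smooth at `x`.) -/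
structure IsPrincipalConnection (ζ : LieAlgebraAction 𝔤 E M)
    (Φ : Π x : M, TangentSpace 𝓘(ℝ, E) x →L[ℝ] TangentSpace 𝓘(ℝ, E) x) : Prop
    extends ζ.IsConnection Φ where
  invariant : ∀ (X : 𝔤) (x : M) (V : Π x : M, TangentSpace 𝓘(ℝ, E) x), SmoothFieldAt V x →
    lieDerivEndo (ζ.field X) Φ V x = 0

/-! ### The isotropy representation -/

theorem mdifferentiableAt_field (ζ : LieAlgebraAction 𝔤 E M) (X : 𝔤) (x : M) :
    MDifferentiableAt 𝓘(ℝ, E) 𝓘(ℝ, E).tangent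
      (fun y : M => (⟨y, ζ.field X y⟩ : TangentBundle 𝓘(ℝ, E) M)) x :=
  ((ζ.smooth X) x).mdifferentiableAt (by simp)

/-- Every tangent vector extends to a vector field which is smooth at the point. -/
theorem exists_smoothFieldAt (x : M) (v : TangentSpace 𝓘(ℝ, E) x) :
    ∃ V : Π x : M, TangentSpace 𝓘(ℝ, E) x, SmoothFieldAt V x ∧ V x = v :=
  ⟨FiberBundle.extend E v, FiberBundle.contMDiffAt_extend 𝓘(ℝ, E) E v, by simp⟩

variable [FiniteDimensional ℝ E]

/-- If `X` lies in the isotropy subalgebra of `x`, then `[ζ_X, V](x)` depends on `V(x)` only. -/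
theorem tensorialAt_isotropy (ζ : LieAlgebraAction 𝔤 E M) (x : M) (X : ζ.isotropy x) :
    TensorialAt 𝓘(ℝ, E) E
      (fun V : (Π x : M, TangentSpace 𝓘(ℝ, E) x) => mlieBracket 𝓘(ℝ, E) (ζ.field X) V x) x := by
  have : CompleteSpace E := FiniteDimensional.complete ℝ E
  have : IsManifold 𝓘(ℝ, E) 2 M := IsManifold.of_le (n := ∞) (by norm_cast)
  constructor
  · intro f V hf hV
    have h0 : ζ.field X x = 0 := X.2
    rw [mlieBracket_smul_right hf hV, h0]
    simp
  · intro V W hV hW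
    exact mlieBracket_add_right hV hW

/-- The endomorphism of `T_x M` by which an element `X` of the isotropy subalgebra acts:
`v ↦ [ζ_X, V](x)` for any vector field `V` near `x` with `V(x) = v`. -/
noncomputable def isotropyEndo (ζ : LieAlgebraAction 𝔤 E M) (x : M) (X : ζ.isotropy x) :
    TangentSpace 𝓘(ℝ, E) x →L[ℝ] TangentSpace 𝓘(ℝ, E) x :=
  haveI : IsManifold 𝓘(ℝ, E) 2 M := IsManifold.of_le (n := ∞) (by norm_cast)
  TensorialAt.mkHom _ x (ζ.tensorialAt_isotropy x X)

theorem isotropyEndo_apply (ζ : LieAlgebraAction 𝔤 E M) (x : M) (X : ζ.isotropy x)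
    {V : Π x : M, TangentSpace 𝓘(ℝ, E) x}
    (hV : MDifferentiableAt 𝓘(ℝ, E) 𝓘(ℝ, E).tangent
      (fun y : M => (⟨y, V y⟩ : TangentBundle 𝓘(ℝ, E) M)) x) :
    ζ.isotropyEndo x X (V x) = mlieBracket 𝓘(ℝ, E) (ζ.field X) V x :=
  haveI : IsManifold 𝓘(ℝ, E) 2 M := IsManifold.of_le (n := ∞) (by norm_cast)
  TensorialAt.mkHom_apply (ζ.tensorialAt_isotropy x X) hV

/-- The (linear, first order) isotropy representation of `𝔤_x` on `T_x M`:
`ρ(X) v = [ζ_X, V](x)` for any vector field `V` near `x` with `V(x) = v`. -/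
noncomputable def isotropyRep (ζ : LieAlgebraAction 𝔤 E M) (x : M) :
    ζ.isotropy x →ₗ[ℝ] Module.End ℝ (TangentSpace 𝓘(ℝ, E) x) where
  toFun X := (ζ.isotropyEndo x X : TangentSpace 𝓘(ℝ, E) x →ₗ[ℝ] TangentSpace 𝓘(ℝ, E) x)
  map_add' X Y := by
    have : CompleteSpace E := FiniteDimensional.complete ℝ E
    have : IsManifold 𝓘(ℝ, E) 2 M := IsManifold.of_le (n := ∞) (by norm_cast)
    ext v
    obtain ⟨V, hV, rfl⟩ := exists_smoothFieldAt x v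
    have hV' := hV.mdifferentiableAt (by simp)
    change ζ.isotropyEndo x (X + Y) (V x) = ζ.isotropyEndo x X (V x) + ζ.isotropyEndo x Y (V x)
    rw [ζ.isotropyEndo_apply x _ hV', ζ.isotropyEndo_apply x _ hV', ζ.isotropyEndo_apply x _ hV',
      ← mlieBracket_add_left (ζ.mdifferentiableAt_field X x) (ζ.mdifferentiableAt_field Y x),
      ← map_add]
    rfl
  map_smul' c X := by
    have : CompleteSpace E := FiniteDimensional.complete ℝ E
    have : IsManifold 𝓘(ℝ, E) 2 M := IsManifold.of_le (n := ∞) (by norm_cast)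
    ext v
    obtain ⟨V, hV, rfl⟩ := exists_smoothFieldAt x v
    have hV' := hV.mdifferentiableAt (by simp)
    change ζ.isotropyEndo x (c • X) (V x) = c • ζ.isotropyEndo x X (V x)
    rw [ζ.isotropyEndo_apply x _ hV', ζ.isotropyEndo_apply x _ hV',
      ← mlieBracket_const_smul_left (ζ.mdifferentiableAt_field X x), ← map_smul]
    rfl

theorem isotropyRep_apply (ζ : LieAlgebraAction 𝔤 E M) (x : M) (X : ζ.isotropy x)
    {V : Π x : M, TangentSpace 𝓘(ℝ, E) x} (hV : SmoothFieldAt V x) :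
    ζ.isotropyRep x X (V x) = mlieBracket 𝓘(ℝ, E) (ζ.field X) V x :=
  ζ.isotropyEndo_apply x X (hV.mdifferentiableAt (by simp))

/-- `isotropyRep` is a representation of the Lie algebra `𝔤_x`. -/
theorem isotropyRep_lie (ζ : LieAlgebraAction 𝔤 E M) (x : M) (X Y : ζ.isotropy x) :
    ζ.isotropyRep x ⁅X, Y⁆ =
      ζ.isotropyRep x X * ζ.isotropyRep x Y - ζ.isotropyRep x Y * ζ.isotropyRep x X := by
  have : CompleteSpace E := FiniteDimensional.complete ℝ E
  have : IsManifold 𝓘(ℝ, E) (minSmoothness ℝ 3) M :=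
    IsManifold.of_le (n := ∞) (by simp only [minSmoothness_of_isRCLikeNormedField]; norm_cast)
  have : IsManifold 𝓘(ℝ, E) ((∞ : WithTop ℕ∞) + 1) M := by simpa using ‹IsManifold 𝓘(ℝ, E) ∞ M›
  ext v
  obtain ⟨V, hV, rfl⟩ := exists_smoothFieldAt x v
  have hbr (Z : 𝔤) : SmoothFieldAt (mlieBracket 𝓘(ℝ, E) (ζ.field Z) V) x :=
    ContMDiffAt.mlieBracket_vectorField (n := (⊤ : ℕ∞)) (m := (⊤ : ℕ∞)) ((ζ.smooth Z) x) hV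
      (by simp)
  have hle : minSmoothness ℝ 2 ≤ (∞ : WithTop ℕ∞) := by
    simp only [minSmoothness_of_isRCLikeNormedField]; norm_cast
  have hjac := leibniz_identity_mlieBracket_apply (((ζ.smooth X) x).of_le hle)
    (((ζ.smooth Y) x).of_le hle) (hV.of_le hle)
  change ζ.isotropyRep x ⁅X, Y⁆ (V x) =
    ζ.isotropyRep x X (ζ.isotropyRep x Y (V x)) - ζ.isotropyRep x Y (ζ.isotropyRep x X (V x))
  rw [ζ.isotropyRep_apply x X hV, ζ.isotropyRep_apply x Y hV, ζ.isotropyRep_apply x _ hV,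
    ζ.isotropyRep_apply x X (hbr Y), ζ.isotropyRep_apply x Y (hbr X), hjac, add_sub_cancel_right]
  congr 1
  funext y
  exact ζ.field_lie X Y y

/-- The subspace of `T_x M` on which the isotropy representation of `𝔤_x` vanishes. -/
noncomputable def isotropyNullspace (ζ : LieAlgebraAction 𝔤 E M) (x : M) :
    Submodule ℝ (TangentSpace 𝓘(ℝ, E) x) :=
  ⨅ X : ζ.isotropy x, LinearMap.ker (ζ.isotropyRep x X)

end LieAlgebraAction

/-! Local triviality gives charts into a vector space `F` with an idempotent `P` for which each
fundamental field takes values in the range of `P`, depends locally only on the `P`-component of the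
point, and at each point these fields fill that range (`IsStraightening`). Hence the derivative `D`
of a fundamental field satisfies `P D = D = D P`.

If `ζ_X` vanishes at `x`, the bracket formula reduces `ρ_x(X)` to `-D` in the chart. So `ρ_x(X)` has
vertical values and kills every vector with zero `P`-part. Asystaticity says exactly that no further
vectors are killed: if `ζ_Y(x)` is annihilated by `ρ_x`, then `ζ_[X,Y](x) = 0` for all `X` in the
isotropy algebra, so `Y` normalizes it and `ζ_Y(x) = 0` (`IsAsystatic.disjoint`). The nullspace of
`ρ_x` is therefore a complement of the vertical space, represented by `ker P` in the chart
(`mem_isotropyNullspace_iff`).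

The projection onto the vertical space along the nullspace is then the constant `P` in these charts.
This makes it smooth and flat, and invariant because `P` commutes with `D`. Conversely, invariance
of a principal connection forces its kernel into the nullspace, hence onto it
(`ker_eq_isotropyNullspace`), and a projection is determined by its range and kernel. -/

/-! ### Vector fields and brackets read in a chart with values in a vector space. -/

section PartialDiffeomorphToVectorSpace

open Filter Topology

variable {E : Type*} [NormedAddCommGroup E] [NormedSpace ℝ E]
  {M : Type*} [TopologicalSpace M] [ChartedSpace E M]
  {F : Type*} [NormedAddCommGroup F] [NormedSpace ℝ F]

namespace PartialDiffeomorph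

theorem mdifferentiableAt_symm (ψ : PartialDiffeomorph 𝓘(ℝ, E) 𝓘(ℝ, F) M F ∞) {x : M}
    (hx : x ∈ ψ.source) : MDifferentiableAt 𝓘(ℝ, F) 𝓘(ℝ, E) ψ.symm (ψ x) :=
  ψ.symm.mdifferentiableAt (by simp) (ψ.map_source hx)

theorem symm_apply_apply (ψ : PartialDiffeomorph 𝓘(ℝ, E) 𝓘(ℝ, F) M F ∞) {x : M}
    (hx : x ∈ ψ.source) : ψ.symm (ψ x) = x :=
  ψ.left_inv hx

theorem apply_symm_apply (ψ : PartialDiffeomorph 𝓘(ℝ, E) 𝓘(ℝ, F) M F ∞) {z : F}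
    (hz : z ∈ ψ.target) : ψ (ψ.symm z) = z :=
  ψ.right_inv hz

theorem mfderiv_symm_mfderiv [IsManifold 𝓘(ℝ, E) ∞ M]
    (ψ : PartialDiffeomorph 𝓘(ℝ, E) 𝓘(ℝ, F) M F ∞) {x : M}
    (hx : x ∈ ψ.source) (v : TangentSpace 𝓘(ℝ, E) x) :
    mfderiv 𝓘(ℝ, F) 𝓘(ℝ, E) ψ.symm (ψ x) (mfderiv 𝓘(ℝ, E) 𝓘(ℝ, F) ψ x v) = v := by
  have h1 := mfderiv_comp x (ψ.mdifferentiableAt_symm hx) (ψ.mdifferentiableAt (by simp) hx)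
  have h2 : (ψ.symm ∘ ψ : M → M) =ᶠ[𝓝 x] id := by
    filter_upwards [ψ.open_source.mem_nhds hx] with y hy using ψ.symm_apply_apply hy
  rw [h2.mfderiv_eq, mfderiv_id] at h1
  exact (congrArg (fun A => A v) h1).symm

theorem mfderiv_mfderiv_symm [IsManifold 𝓘(ℝ, E) ∞ M]
    (ψ : PartialDiffeomorph 𝓘(ℝ, E) 𝓘(ℝ, F) M F ∞) {x : M}
    (hx : x ∈ ψ.source) (w : F) :
    mfderiv 𝓘(ℝ, E) 𝓘(ℝ, F) ψ x (mfderiv 𝓘(ℝ, F) 𝓘(ℝ, E) ψ.symm (ψ x) w) = w := by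
  have hx' := ψ.symm_apply_apply hx
  have h0 : MDifferentiableAt 𝓘(ℝ, E) 𝓘(ℝ, F) ψ (ψ.symm (ψ x)) := by
    rw [hx']; exact ψ.mdifferentiableAt (by simp) hx
  have h1 := mfderiv_comp (ψ x) h0 (ψ.mdifferentiableAt_symm hx)
  have h2 : (ψ ∘ ψ.symm : F → F) =ᶠ[𝓝 (ψ x)] id := by
    filter_upwards [ψ.open_target.mem_nhds (ψ.map_source hx)] with y hy
      using ψ.apply_symm_apply hy
  rw [h2.mfderiv_eq, mfderiv_id] at h1
  have h3 := (congrArg (fun A => A w) h1).symm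
  rw [hx'] at h3
  exact h3

/-- The pullback of vector fields is defined with an inverse that defaults to zero at non-invertible
derivatives; this rules out the default. -/
theorem isInvertible_mfderiv_symm [IsManifold 𝓘(ℝ, E) ∞ M]
    (ψ : PartialDiffeomorph 𝓘(ℝ, E) 𝓘(ℝ, F) M F ∞) {x : M} (hx : x ∈ ψ.source) :
    (mfderiv 𝓘(ℝ, F) 𝓘(ℝ, E) ψ.symm (ψ x)).IsInvertible := by
  rw [ψ.symm_apply_apply hx]
  exact ContinuousLinearMap.IsInvertible.of_inverse (g := mfderiv 𝓘(ℝ, E) 𝓘(ℝ, F) ψ x)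
    (ContinuousLinearMap.ext fun v => ψ.mfderiv_symm_mfderiv hx v)
    (ContinuousLinearMap.ext fun w => ψ.mfderiv_mfderiv_symm hx w)

/-- The vector field `V` transported to the vector space `F`. -/
noncomputable def transport (ψ : PartialDiffeomorph 𝓘(ℝ, E) 𝓘(ℝ, F) M F ∞)
    (V : Π x : M, TangentSpace 𝓘(ℝ, E) x) : F → F :=
  mpullback 𝓘(ℝ, F) 𝓘(ℝ, E) ψ.symm V

theorem transport_apply [IsManifold 𝓘(ℝ, E) ∞ M]
    (ψ : PartialDiffeomorph 𝓘(ℝ, E) 𝓘(ℝ, F) M F ∞)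
    (V : Π x : M, TangentSpace 𝓘(ℝ, E) x) {x : M} (hx : x ∈ ψ.source) :
    ψ.transport V (ψ x) = mfderiv 𝓘(ℝ, E) 𝓘(ℝ, F) ψ x (V x) := by
  have hx' := ψ.symm_apply_apply hx
  refine ((ψ.isInvertible_mfderiv_symm hx).inverse_apply_eq).2 ?_
  have h := ψ.mfderiv_symm_mfderiv hx (V x)
  refine Eq.trans ?_ h.symm
  rw [hx']

theorem differentiableAt_transport [CompleteSpace E] [CompleteSpace F] [IsManifold 𝓘(ℝ, E) ∞ M]
    (ψ : PartialDiffeomorph 𝓘(ℝ, E) 𝓘(ℝ, F) M F ∞)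
    {V : Π x : M, TangentSpace 𝓘(ℝ, E) x} {x : M} (hx : x ∈ ψ.source) (hV : SmoothFieldAt V x) :
    DifferentiableAt ℝ (ψ.transport V) (ψ x) := by
  have hf : ContMDiffAt 𝓘(ℝ, F) 𝓘(ℝ, E) ∞ ψ.symm (ψ x) :=
    ψ.symm.contMDiffOn.contMDiffAt (ψ.open_target.mem_nhds (ψ.map_source hx))
  have hV' : ContMDiffAt 𝓘(ℝ, E) 𝓘(ℝ, E).tangent 1
    (fun y : M => (⟨y, V y⟩ : TangentBundle 𝓘(ℝ, E) M)) (ψ.symm (ψ x)) := by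
    rw [ψ.symm_apply_apply hx]; exact ContMDiffAt.of_le hV (by norm_cast)
  have h := ContMDiffAt.mpullback_vectorField_preimage (m := 1) (n := ∞) hV' hf
    (ψ.isInvertible_mfderiv_symm hx) (by norm_cast)
  exact (contMDiffAt_vectorSpace_iff_contDiffAt.1 h).differentiableAt (by simp)

/-- Naturality of the bracket under pullback along `ψ.symm`. Every later bracket computation on the
manifold is reduced by it to derivatives in `F`. -/
theorem mfderiv_mlieBracket [CompleteSpace E] [CompleteSpace F] [IsManifold 𝓘(ℝ, E) ∞ M]
    (ψ : PartialDiffeomorph 𝓘(ℝ, E) 𝓘(ℝ, F) M F ∞)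
    {V W : Π x : M, TangentSpace 𝓘(ℝ, E) x} {x : M} (hx : x ∈ ψ.source)
    (hV : SmoothFieldAt V x) (hW : SmoothFieldAt W x) :
    mfderiv 𝓘(ℝ, E) 𝓘(ℝ, F) ψ x (mlieBracket 𝓘(ℝ, E) V W x) =
      lieBracket ℝ (ψ.transport V) (ψ.transport W) (ψ x) := by
  have : IsManifold 𝓘(ℝ, E) (minSmoothness ℝ 3) M :=
    IsManifold.of_le (n := ∞) (by simp only [minSmoothness_of_isRCLikeNormedField]; norm_cast)
  have hf : ContMDiffAt 𝓘(ℝ, F) 𝓘(ℝ, E) ∞ ψ.symm (ψ x) :=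
    ψ.symm.contMDiffOn.contMDiffAt (ψ.open_target.mem_nhds (ψ.map_source hx))
  have hV' : MDifferentiableAt 𝓘(ℝ, E) 𝓘(ℝ, E).tangent
    (fun y : M => (⟨y, V y⟩ : TangentBundle 𝓘(ℝ, E) M)) (ψ.symm (ψ x)) := by
    rw [ψ.symm_apply_apply hx]; exact hV.mdifferentiableAt (by simp)
  have hW' : MDifferentiableAt 𝓘(ℝ, E) 𝓘(ℝ, E).tangent
    (fun y : M => (⟨y, W y⟩ : TangentBundle 𝓘(ℝ, E) M)) (ψ.symm (ψ x)) := by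
    rw [ψ.symm_apply_apply hx]; exact hW.mdifferentiableAt (by simp)
  have h := mpullback_mlieBracket hV' hW' hf
    (by simp only [minSmoothness_of_isRCLikeNormedField]; norm_cast)
  rw [← ψ.transport_apply _ hx]
  refine h.trans ?_
  rw [← mlieBracketWithin_univ, mlieBracketWithin_eq_lieBracketWithin]
  exact congrFun (lieBracketWithin_univ (𝕜 := ℝ) (V := ψ.transport V) (W := ψ.transport W)) _

end PartialDiffeomorph

end PartialDiffeomorphToVectorSpace

/-! ### Straightened actions and the isotropy representation. -/

namespace LieAlgebraAction

open Filter Topology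

variable {𝔤 : Type*} [LieRing 𝔤] [LieAlgebra ℝ 𝔤]
  {E : Type*} [NormedAddCommGroup E] [NormedSpace ℝ E]
  {M : Type*} [TopologicalSpace M] [ChartedSpace E M] [IsManifold 𝓘(ℝ, E) ∞ M]
  {F : Type*} [NormedAddCommGroup F] [NormedSpace ℝ F]

/-- The chart `ψ` and the idempotent `P` straighten the action: in the chart, the fundamental
vector fields take values in the range of `P`, they span it, and they are locally constant in the
directions of the kernel of `P`. -/
structure IsStraightening (ζ : LieAlgebraAction 𝔤 E M)
    (ψ : PartialDiffeomorph 𝓘(ℝ, E) 𝓘(ℝ, F) M F ∞) (P : F →L[ℝ] F) : Prop where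
  idem : ∀ w, P (P w) = P w
  apply_transport : ∀ X : 𝔤, ∀ z ∈ ψ.target,
    P (ψ.transport (ζ.field X) z) = ψ.transport (ζ.field X) z
  eventually_eq : ∀ X : 𝔤, ∀ z ∈ ψ.target, ∀ᶠ z' in 𝓝 z,
    ψ.transport (ζ.field X) z' = ψ.transport (ζ.field X) (z + P (z' - z))
  exists_eq : ∀ z ∈ ψ.target, ∀ w, ∃ X : 𝔤, ψ.transport (ζ.field X) z = P w

namespace IsStraightening

variable {ζ : LieAlgebraAction 𝔤 E M}
  {ψ : PartialDiffeomorph 𝓘(ℝ, E) 𝓘(ℝ, F) M F ∞} {P : F →L[ℝ] F}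

theorem mem_vertical_iff (h : ζ.IsStraightening ψ P) {x : M} (hx : x ∈ ψ.source)
    (v : TangentSpace 𝓘(ℝ, E) x) :
    v ∈ ζ.vertical x ↔
      P (mfderiv 𝓘(ℝ, E) 𝓘(ℝ, F) ψ x v) = mfderiv 𝓘(ℝ, E) 𝓘(ℝ, F) ψ x v := by
  constructor
  · rintro ⟨X, rfl⟩
    have := h.apply_transport X (ψ x) (ψ.map_source hx)
    rwa [ψ.transport_apply _ hx] at this
  · intro hv
    obtain ⟨X, hX⟩ := h.exists_eq (ψ x) (ψ.map_source hx) (mfderiv 𝓘(ℝ, E) 𝓘(ℝ, F) ψ x v)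
    refine ⟨X, ?_⟩
    rw [ψ.transport_apply _ hx] at hX
    have h1 := ψ.mfderiv_symm_mfderiv hx (ζ.field X x)
    have h2 := ψ.mfderiv_symm_mfderiv hx v
    rw [← hv, ← hX, h1] at h2
    exact h2

variable [CompleteSpace E] [CompleteSpace F]

theorem differentiableAt (ζ : LieAlgebraAction 𝔤 E M)
    (ψ : PartialDiffeomorph 𝓘(ℝ, E) 𝓘(ℝ, F) M F ∞) {x : M} (hx : x ∈ ψ.source) (X : 𝔤) :
    DifferentiableAt ℝ (ψ.transport (ζ.field X)) (ψ x) :=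
  ψ.differentiableAt_transport hx (ζ.smooth X x)

/-- Near `ψ x` the field equals its composite with the affine map `z' ↦ ψ x + P (z' - ψ x)`, whose
derivative is `P`; the chain rule and uniqueness of derivatives conclude. -/
theorem fderiv_apply_proj (h : ζ.IsStraightening ψ P) {x : M} (hx : x ∈ ψ.source) (X : 𝔤) (w : F) :
    fderiv ℝ (ψ.transport (ζ.field X)) (ψ x) (P w) =
      fderiv ℝ (ψ.transport (ζ.field X)) (ψ x) w := by
  have hz := ψ.map_source hx
  have hd := (differentiableAt ζ ψ hx X).hasFDerivAt
  have hg : HasFDerivAt (fun z' : F => ψ x + P (z' - ψ x)) P (ψ x) := by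
    have h0 : HasFDerivAt (fun z' : F => z' - ψ x) (ContinuousLinearMap.id ℝ F) (ψ x) :=
      (hasFDerivAt_id (ψ x)).sub_const (ψ x)
    have h1 : HasFDerivAt (fun z' : F => P (z' - ψ x)) P (ψ x) := P.hasFDerivAt.comp (ψ x) h0
    exact h1.const_add (ψ x)
  have hd' : HasFDerivAt (ψ.transport (ζ.field X))
      (fderiv ℝ (ψ.transport (ζ.field X)) (ψ x)) (ψ x + P (ψ x - ψ x)) := by simpa using hd
  have h1 := (hd'.comp (ψ x) hg).congr_of_eventuallyEq (h.eventually_eq X (ψ x) hz)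
  exact (congrArg (fun A => A w) (hd.unique h1)).symm

/-- Differentiating the identity `P ∘ ζ_X = ζ_X`, valid on the open target of the chart. -/
theorem proj_fderiv (h : ζ.IsStraightening ψ P) {x : M} (hx : x ∈ ψ.source) (X : 𝔤) (w : F) :
    P (fderiv ℝ (ψ.transport (ζ.field X)) (ψ x) w) =
      fderiv ℝ (ψ.transport (ζ.field X)) (ψ x) w := by
  have hz := ψ.map_source hx
  have hd := (differentiableAt ζ ψ hx X).hasFDerivAt
  have h1 : HasFDerivAt (ψ.transport (ζ.field X))
      (P.comp (fderiv ℝ (ψ.transport (ζ.field X)) (ψ x))) (ψ x) := by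
    refine ((P.hasFDerivAt).comp (ψ x) hd).congr_of_eventuallyEq ?_
    filter_upwards [ψ.open_target.mem_nhds hz] with z hz' using (h.apply_transport X z hz').symm
  exact (congrArg (fun A => A w) (hd.unique h1)).symm

variable [FiniteDimensional ℝ E]

/-- Of the two terms of the bracket, the one differentiating the extension of `v` is evaluated in
the direction `ζ_X(x) = 0` and drops out. -/
theorem mfderiv_isotropyRep (ψ : PartialDiffeomorph 𝓘(ℝ, E) 𝓘(ℝ, F) M F ∞)
    {x : M} (hx : x ∈ ψ.source) (X : ζ.isotropy x) (v : TangentSpace 𝓘(ℝ, E) x) :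
    mfderiv 𝓘(ℝ, E) 𝓘(ℝ, F) ψ x (ζ.isotropyRep x X v) =
      - fderiv ℝ (ψ.transport (ζ.field X)) (ψ x) (mfderiv 𝓘(ℝ, E) 𝓘(ℝ, F) ψ x v) := by
  obtain ⟨V, hV, rfl⟩ := exists_smoothFieldAt x v
  have h0 : ζ.field X x = 0 := X.2
  rw [ζ.isotropyRep_apply x X hV, ψ.mfderiv_mlieBracket hx (ζ.smooth X x) hV, lieBracket,
    ψ.transport_apply _ hx, ψ.transport_apply _ hx, h0]
  have h1 : mfderiv 𝓘(ℝ, E) 𝓘(ℝ, F) ψ x (0 : TangentSpace 𝓘(ℝ, E) x) = 0 := map_zero _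
  rw [h1]
  exact (congrArg₂ (· - ·) (map_zero _) rfl).trans (zero_sub _)

theorem isotropyRep_mem_vertical (h : ζ.IsStraightening ψ P) {x : M} (hx : x ∈ ψ.source)
    (X : ζ.isotropy x) (v : TangentSpace 𝓘(ℝ, E) x) : ζ.isotropyRep x X v ∈ ζ.vertical x := by
  rw [h.mem_vertical_iff hx, mfderiv_isotropyRep ψ hx]
  exact (map_neg P _).trans (congrArg _ (h.proj_fderiv hx X _))

/-- The derivative of a fundamental field factors through `P`, so it kills the kernel of `P`. This
half of the description of the nullspace does not need asystaticity. -/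
theorem mem_isotropyNullspace_of_proj_eq_zero (h : ζ.IsStraightening ψ P) {x : M}
    (hx : x ∈ ψ.source) {v : TangentSpace 𝓘(ℝ, E) x}
    (hv : P (mfderiv 𝓘(ℝ, E) 𝓘(ℝ, F) ψ x v) = 0) : v ∈ ζ.isotropyNullspace x := by
  rw [isotropyNullspace, Submodule.mem_iInf]
  intro X
  have h1 : fderiv ℝ (ψ.transport (ζ.field X)) (ψ x) (mfderiv 𝓘(ℝ, E) 𝓘(ℝ, F) ψ x v) = 0 :=
    (h.fderiv_apply_proj hx X _).symm.trans ((congrArg _ hv).trans (map_zero _))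
  have h2 := mfderiv_isotropyRep ψ hx X v
  rw [h1] at h2
  have h3 := ψ.mfderiv_symm_mfderiv hx (ζ.isotropyRep x X v)
  rw [h2] at h3
  rw [LinearMap.mem_ker, ← h3]
  exact (congrArg _ neg_zero).trans (map_zero _)

end IsStraightening

variable [FiniteDimensional ℝ E]

/-- For an asystatic action, no nonzero vertical vector is fixed by the isotropy representation. -/
theorem IsAsystatic.disjoint {ζ : LieAlgebraAction 𝔤 E M} (hasy : ζ.IsAsystatic) (x : M) :
    Disjoint (ζ.vertical x) (ζ.isotropyNullspace x) := by
  rw [Submodule.disjoint_def]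
  rintro _ ⟨Y, rfl⟩ hv
  rw [isotropyNullspace, Submodule.mem_iInf] at hv
  change ζ.field Y x = 0
  -- It suffices that `Y` normalizes the isotropy algebra; for `X` in that algebra, `ζ_[X,Y](x)` is
  -- the isotropy action of `X` on `ζ_Y(x)`.
  rw [← mem_isotropy, ← hasy x, LieSubalgebra.mem_normalizer_iff']
  intro X hX
  rw [mem_isotropy, ζ.field_lie, ← ζ.isotropyRep_apply x ⟨X, hX⟩ (ζ.smooth Y x)]
  exact hv ⟨X, hX⟩

end LieAlgebraAction

/-! ### Brackets of vector fields composed with a constant endomorphism. -/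

section ConstantProjection

variable {F : Type*} [NormedAddCommGroup F] [NormedSpace ℝ F]

theorem lieBracket_proj_right (P : F →L[ℝ] F) {Z V : F → F} {z : F}
    (hV : DifferentiableAt ℝ V z) :
    lieBracket ℝ Z (fun y => P (V y)) z = P (fderiv ℝ V z (Z z)) - fderiv ℝ Z z (P (V z)) := by
  have h : fderiv ℝ (fun y => P (V y)) z = P.comp (fderiv ℝ V z) :=
    ((P.hasFDerivAt).comp z hV.hasFDerivAt).fderiv
  rw [lieBracket, h]
  rfl

theorem lieBracket_proj_left (P : F →L[ℝ] F) {V Z : F → F} {z : F}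
    (hV : DifferentiableAt ℝ V z) :
    lieBracket ℝ (fun y => P (V y)) Z z = fderiv ℝ Z z (P (V z)) - P (fderiv ℝ V z (Z z)) := by
  have h : fderiv ℝ (fun y => P (V y)) z = P.comp (fderiv ℝ V z) :=
    ((P.hasFDerivAt).comp z hV.hasFDerivAt).fderiv
  rw [lieBracket, h]
  rfl

theorem lieBracket_proj_proj (P : F →L[ℝ] F) {V W : F → F} {z : F}
    (hV : DifferentiableAt ℝ V z) (hW : DifferentiableAt ℝ W z) :
    lieBracket ℝ (fun y => P (V y)) (fun y => P (W y)) z =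
      P (fderiv ℝ W z (P (V z))) - P (fderiv ℝ V z (P (W z))) := by
  have h : fderiv ℝ (fun y => P (V y)) z = P.comp (fderiv ℝ V z) :=
    ((P.hasFDerivAt).comp z hV.hasFDerivAt).fderiv
  rw [lieBracket_proj_right P hW, h]
  rfl

end ConstantProjection

/-! ### Endomorphism fields that are constant in a chart: smoothness and curvature. -/

section EndomorphismFields

open Filter Topology

variable {E : Type*} [NormedAddCommGroup E] [NormedSpace ℝ E]
  {M : Type*} [TopologicalSpace M] [ChartedSpace E M] [IsManifold 𝓘(ℝ, E) ∞ M]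
  {F : Type*} [NormedAddCommGroup F] [NormedSpace ℝ F]

theorem SmoothEndo.smoothFieldAt
    {K : Π x : M, TangentSpace 𝓘(ℝ, E) x →L[ℝ] TangentSpace 𝓘(ℝ, E) x} (hK : SmoothEndo K)
    {V : Π x : M, TangentSpace 𝓘(ℝ, E) x} {x : M} (hV : SmoothFieldAt V x) :
    SmoothFieldAt (fun y => K y (V y)) x :=
  ContMDiffAt.comp (g := fun a : TangentBundle 𝓘(ℝ, E) M =>
      (⟨a.proj, K a.proj a.2⟩ : TangentBundle 𝓘(ℝ, E) M))
    (f := fun y : M => (⟨y, V y⟩ : TangentBundle 𝓘(ℝ, E) M)) x (hK _) hV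

theorem contMDiff_tangentBundle_const (P : F →L[ℝ] F) :
    ContMDiff 𝓘(ℝ, F).tangent 𝓘(ℝ, F).tangent ∞
      (fun a : TangentBundle 𝓘(ℝ, F) F => (⟨a.proj, P a.2⟩ : TangentBundle 𝓘(ℝ, F) F)) := by
  intro a
  refine contMDiffAt_totalSpace.2 ⟨contMDiff_proj _ a, ?_⟩
  have h : ContMDiff 𝓘(ℝ, F).tangent 𝓘(ℝ, F) ∞ (fun a : TangentBundle 𝓘(ℝ, F) F => P a.2) :=
    P.contMDiff.comp (contMDiff_snd_tangentBundle_modelSpace F 𝓘(ℝ, F))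
  convert! h a with b
  simp

/-- The field of endomorphisms `K` is given by the constant endomorphism `P` in the chart `ψ`. -/
def IsConstantInChart (K : Π x : M, TangentSpace 𝓘(ℝ, E) x →L[ℝ] TangentSpace 𝓘(ℝ, E) x)
    (ψ : PartialDiffeomorph 𝓘(ℝ, E) 𝓘(ℝ, F) M F ∞) (P : F →L[ℝ] F) : Prop :=
  ∀ x ∈ ψ.source, ∀ v : TangentSpace 𝓘(ℝ, E) x,
    mfderiv 𝓘(ℝ, E) 𝓘(ℝ, F) ψ x (K x v) = P (mfderiv 𝓘(ℝ, E) 𝓘(ℝ, F) ψ x v)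

namespace IsConstantInChart

variable {K : Π x : M, TangentSpace 𝓘(ℝ, E) x →L[ℝ] TangentSpace 𝓘(ℝ, E) x}
  {ψ : PartialDiffeomorph 𝓘(ℝ, E) 𝓘(ℝ, F) M F ∞} {P : F →L[ℝ] F}

/-- Over the chart domain, `K` is the composite of the tangent map of `ψ`, the constant bundle map
`P`, and the tangent map of `ψ.symm`, all smooth. -/
theorem contMDiffAt (h : IsConstantInChart K ψ P) (a : TangentBundle 𝓘(ℝ, E) M)
    (ha : a.proj ∈ ψ.source) :
    ContMDiffAt 𝓘(ℝ, E).tangent 𝓘(ℝ, E).tangent ∞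
      (fun a : TangentBundle 𝓘(ℝ, E) M => (⟨a.proj, K a.proj a.2⟩ : TangentBundle 𝓘(ℝ, E) M))
      a := by
  have h1 : ContMDiffOn 𝓘(ℝ, E).tangent 𝓘(ℝ, F).tangent ∞
      (tangentMapWithin 𝓘(ℝ, E) 𝓘(ℝ, F) ψ ψ.source) (π E (TangentSpace 𝓘(ℝ, E)) ⁻¹' ψ.source) :=
    ψ.contMDiffOn.contMDiffOn_tangentMapWithin (by norm_cast) ψ.open_source.uniqueMDiffOn
  have h2 : ContMDiffOn 𝓘(ℝ, F).tangent 𝓘(ℝ, E).tangent ∞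
      (tangentMapWithin 𝓘(ℝ, F) 𝓘(ℝ, E) ψ.symm ψ.target)
      (π F (TangentSpace 𝓘(ℝ, F)) ⁻¹' ψ.target) :=
    ψ.symm.contMDiffOn.contMDiffOn_tangentMapWithin (by norm_cast) ψ.open_target.uniqueMDiffOn
  have hopen : IsOpen (π E (TangentSpace 𝓘(ℝ, E)) ⁻¹' ψ.source) :=
    ψ.open_source.preimage (FiberBundle.continuous_proj E (TangentSpace 𝓘(ℝ, E)))
  have h3 := h2.comp (t := π F (TangentSpace 𝓘(ℝ, F)) ⁻¹' ψ.target)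
    (s := π E (TangentSpace 𝓘(ℝ, E)) ⁻¹' ψ.source)
    ((contMDiff_tangentBundle_const P).comp_contMDiffOn h1)
    (fun b hb => ψ.map_source hb)
  refine (h3.congr ?_).contMDiffAt (hopen.mem_nhds ha)
  intro b hb
  have hb' : b.proj ∈ ψ.source := hb
  have hx := ψ.symm_apply_apply hb'
  have e1 : mfderivWithin 𝓘(ℝ, E) 𝓘(ℝ, F) ψ ψ.source b.proj = mfderiv 𝓘(ℝ, E) 𝓘(ℝ, F) ψ b.proj :=
    mfderivWithin_of_isOpen ψ.open_source hb'
  have e2 : mfderivWithin 𝓘(ℝ, F) 𝓘(ℝ, E) ψ.symm ψ.target (ψ b.proj) =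
      mfderiv 𝓘(ℝ, F) 𝓘(ℝ, E) ψ.symm (ψ b.proj) :=
    mfderivWithin_of_isOpen ψ.open_target (ψ.map_source hb')
  have e3 := ψ.mfderiv_symm_mfderiv hb' (K b.proj b.2)
  rw [h b.proj hb' b.2, ← e1, ← e2] at e3
  have hmk {y y' : M} {u u' : E} (hy : y = y') (hu : u = u') :
      (⟨y, u⟩ : TangentBundle 𝓘(ℝ, E) M) = ⟨y', u'⟩ := by rw [hy, hu]
  exact hmk hx.symm e3.symm

theorem transport_eventuallyEq (h : IsConstantInChart K ψ P) {x : M} (hx : x ∈ ψ.source)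
    (V : Π x : M, TangentSpace 𝓘(ℝ, E) x) :
    ψ.transport (fun y => K y (V y)) =ᶠ[𝓝 (ψ x)] fun z => P (ψ.transport V z) := by
  filter_upwards [ψ.open_target.mem_nhds (ψ.map_source hx)] with z hz
  have hy : ψ.symm z ∈ ψ.source := ψ.map_target hz
  have h1 := ψ.transport_apply (fun y => K y (V y)) hy
  have h2 := ψ.transport_apply V hy
  rw [ψ.apply_symm_apply hz] at h1 h2
  rw [h1, h2]
  exact h _ hy _

variable [CompleteSpace E] [CompleteSpace F]

theorem mfderiv_mlieBracket_right (h : IsConstantInChart K ψ P) (hK : SmoothEndo K)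
    {x : M} (hx : x ∈ ψ.source) {Z V : Π x : M, TangentSpace 𝓘(ℝ, E) x}
    (hZ : SmoothFieldAt Z x) (hV : SmoothFieldAt V x) :
    mfderiv 𝓘(ℝ, E) 𝓘(ℝ, F) ψ x (mlieBracket 𝓘(ℝ, E) Z (fun y => K y (V y)) x) =
      P (fderiv ℝ (ψ.transport V) (ψ x) (ψ.transport Z (ψ x)))
        - fderiv ℝ (ψ.transport Z) (ψ x) (P (ψ.transport V (ψ x))) := by
  rw [ψ.mfderiv_mlieBracket hx hZ (hK.smoothFieldAt hV),
    EventuallyEq.rfl.lieBracket_vectorField_eq (h.transport_eventuallyEq hx V),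
    lieBracket_proj_right P (ψ.differentiableAt_transport hx hV)]

theorem mfderiv_mlieBracket_left (h : IsConstantInChart K ψ P) (hK : SmoothEndo K)
    {x : M} (hx : x ∈ ψ.source) {V Z : Π x : M, TangentSpace 𝓘(ℝ, E) x}
    (hV : SmoothFieldAt V x) (hZ : SmoothFieldAt Z x) :
    mfderiv 𝓘(ℝ, E) 𝓘(ℝ, F) ψ x (mlieBracket 𝓘(ℝ, E) (fun y => K y (V y)) Z x) =
      fderiv ℝ (ψ.transport Z) (ψ x) (P (ψ.transport V (ψ x)))
        - P (fderiv ℝ (ψ.transport V) (ψ x) (ψ.transport Z (ψ x))) := by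
  rw [ψ.mfderiv_mlieBracket hx (hK.smoothFieldAt hV) hZ,
    (h.transport_eventuallyEq hx V).lieBracket_vectorField_eq EventuallyEq.rfl,
    lieBracket_proj_left P (ψ.differentiableAt_transport hx hV)]

theorem mfderiv_mlieBracket_both (h : IsConstantInChart K ψ P) (hK : SmoothEndo K)
    {x : M} (hx : x ∈ ψ.source) {V W : Π x : M, TangentSpace 𝓘(ℝ, E) x}
    (hV : SmoothFieldAt V x) (hW : SmoothFieldAt W x) :
    mfderiv 𝓘(ℝ, E) 𝓘(ℝ, F) ψ x
        (mlieBracket 𝓘(ℝ, E) (fun y => K y (V y)) (fun y => K y (W y)) x) =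
      P (fderiv ℝ (ψ.transport W) (ψ x) (P (ψ.transport V (ψ x))))
        - P (fderiv ℝ (ψ.transport V) (ψ x) (P (ψ.transport W (ψ x)))) := by
  rw [ψ.mfderiv_mlieBracket hx (hK.smoothFieldAt hV) (hK.smoothFieldAt hW),
    (h.transport_eventuallyEq hx V).lieBracket_vectorField_eq (h.transport_eventuallyEq hx W),
    lieBracket_proj_proj P (ψ.differentiableAt_transport hx hV)
      (ψ.differentiableAt_transport hx hW)]

/-- With constant coefficients, every term of the Frölicher–Nijenhuis bracket is a first derivative
of `V` or `W` composed with copies of `P`; these cancel once `P² = P` is used. -/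
theorem connectionCurvature_eq_zero (h : IsConstantInChart K ψ P) (hK : SmoothEndo K)
    (hP : ∀ w, P (P w) = P w) {x : M} (hx : x ∈ ψ.source)
    {V W : Π x : M, TangentSpace 𝓘(ℝ, E) x}
    (hV : SmoothFieldAt V x) (hW : SmoothFieldAt W x) :
    connectionCurvature K V W x = 0 := by
  suffices hs : frolicherNijenhuis K K V W x = 0 by rw [connectionCurvature, hs, smul_zero]
  have hinj (u : TangentSpace 𝓘(ℝ, E) x) (hu : mfderiv 𝓘(ℝ, E) 𝓘(ℝ, F) ψ x u = 0) : u = 0 := by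
    rw [← ψ.mfderiv_symm_mfderiv hx u, hu]
    exact map_zero _
  apply hinj
  -- The tangent spaces are replaced by their models `E` and `F`, so that the whole expression
  -- becomes plain linear algebra.
  let d : E →L[ℝ] F := mfderiv 𝓘(ℝ, E) 𝓘(ℝ, F) ψ x
  let k : E →L[ℝ] E := K x
  have hk (u : E) : d (k u) = P (d u) := h x hx u
  let b (A B : Π x : M, TangentSpace 𝓘(ℝ, E) x) : E := mlieBracket 𝓘(ℝ, E) A B x
  let V' : Π x : M, TangentSpace 𝓘(ℝ, E) x := fun y => K y (V y)
  let W' : Π x : M, TangentSpace 𝓘(ℝ, E) x := fun y => K y (W y)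
  change d ((b V' W' - b W' V') - k (b V' W - b W' V) - k (b V' W - b W' V)
    + k (k (b V W)) + k (k (b V W))) = 0
  have e1 := h.mfderiv_mlieBracket_both hK hx hV hW
  have e2 := h.mfderiv_mlieBracket_both hK hx hW hV
  have e3 := h.mfderiv_mlieBracket_left hK hx hV hW
  have e4 := h.mfderiv_mlieBracket_left hK hx hW hV
  have e5 := ψ.mfderiv_mlieBracket hx hV hW
  rw [lieBracket] at e5
  change d (b V' W') = _ at e1
  change d (b W' V') = _ at e2
  change d (b V' W) = _ at e3
  change d (b W' V) = _ at e4
  change d (b V W) = _ at e5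
  simp only [map_add, map_sub, hk, e1, e2, e3, e4, e5, hP]
  abel

end IsConstantInChart

end EndomorphismFields

/-! ### The projection along the nullspace, and the kernel of a principal connection. -/

namespace LieAlgebraAction

open Filter Topology

variable {𝔤 : Type*} [LieRing 𝔤] [LieAlgebra ℝ 𝔤]
  {E : Type*} [NormedAddCommGroup E] [NormedSpace ℝ E]
  {M : Type*} [TopologicalSpace M] [ChartedSpace E M] [IsManifold 𝓘(ℝ, E) ∞ M]
  {F : Type*} [NormedAddCommGroup F] [NormedSpace ℝ F] [CompleteSpace F]
  {ζ : LieAlgebraAction 𝔤 E M}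

theorem eq_of_isProj_of_ker_eq {x : M}
    {T T' : TangentSpace 𝓘(ℝ, E) x →L[ℝ] TangentSpace 𝓘(ℝ, E) x}
    (hT : LinearMap.IsProj (ζ.vertical x) (T : TangentSpace 𝓘(ℝ, E) x →ₗ[ℝ] TangentSpace 𝓘(ℝ, E) x))
    (hT' : LinearMap.IsProj (ζ.vertical x) (T' : TangentSpace 𝓘(ℝ, E) x →ₗ[ℝ] TangentSpace 𝓘(ℝ, E) x))
    (hker : LinearMap.ker (T : TangentSpace 𝓘(ℝ, E) x →ₗ[ℝ] TangentSpace 𝓘(ℝ, E) x) =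
      LinearMap.ker (T' : TangentSpace 𝓘(ℝ, E) x →ₗ[ℝ] TangentSpace 𝓘(ℝ, E) x)) : T = T' := by
  ext v
  have h1 : T v ∈ ζ.vertical x := hT.map_mem v
  have h2 : v - T v ∈ LinearMap.ker (T' : TangentSpace 𝓘(ℝ, E) x →ₗ[ℝ] TangentSpace 𝓘(ℝ, E) x) := by
    rw [← hker, LinearMap.mem_ker, map_sub, sub_eq_zero]
    exact (hT.map_id _ h1).symm
  rw [LinearMap.mem_ker, map_sub, sub_eq_zero] at h2
  exact ((hT'.map_id _ h1).symm.trans h2.symm)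

variable [FiniteDimensional ℝ E]

namespace IsStraightening

variable {ψ : PartialDiffeomorph 𝓘(ℝ, E) 𝓘(ℝ, F) M F ∞} {P : F →L[ℝ] F}

theorem mem_isotropyNullspace_iff (h : ζ.IsStraightening ψ P) (hasy : ζ.IsAsystatic) {x : M}
    (hx : x ∈ ψ.source) (v : TangentSpace 𝓘(ℝ, E) x) :
    v ∈ ζ.isotropyNullspace x ↔ P (mfderiv 𝓘(ℝ, E) 𝓘(ℝ, F) ψ x v) = 0 := by
  have : CompleteSpace E := FiniteDimensional.complete ℝ E
  refine ⟨fun hv => ?_, h.mem_isotropyNullspace_of_proj_eq_zero hx⟩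
  -- `u` is the vertical part of `v`. Since `v - u` has zero `P`-part it lies in the nullspace,
  -- hence so does `u`, and asystaticity gives `u = 0`.
  let w : F := P (mfderiv 𝓘(ℝ, E) 𝓘(ℝ, F) ψ x v)
  let u : TangentSpace 𝓘(ℝ, E) x := by
    exact (mfderiv 𝓘(ℝ, F) 𝓘(ℝ, E) ψ.symm (ψ x) w : E)
  have hu : mfderiv 𝓘(ℝ, E) 𝓘(ℝ, F) ψ x u = w := ψ.mfderiv_mfderiv_symm hx w
  have huv : u ∈ ζ.vertical x := by
    rw [h.mem_vertical_iff hx, hu]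
    exact h.idem _
  have hsub : v - u ∈ ζ.isotropyNullspace x := by
    apply h.mem_isotropyNullspace_of_proj_eq_zero hx
    have h1 : mfderiv 𝓘(ℝ, E) 𝓘(ℝ, F) ψ x (v - u) =
      mfderiv 𝓘(ℝ, E) 𝓘(ℝ, F) ψ x v - mfderiv 𝓘(ℝ, E) 𝓘(ℝ, F) ψ x u := map_sub _ _ _
    rw [h1]
    exact (map_sub P _ _).trans (sub_eq_zero.2 ((congrArg P hu).trans (h.idem _)).symm)
  have hun : u ∈ ζ.isotropyNullspace x := by
    have := sub_mem hv hsub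
    rwa [sub_sub_cancel] at this
  have hu0 := Submodule.disjoint_def.1 (hasy.disjoint x) u huv hun
  rw [hu0] at hu
  exact hu.symm.trans (map_zero _)

/-- In a straightening chart, the projection onto the vertical space along the nullspace of the
isotropy representation is constant. -/
theorem mfderiv_apply_of_isProj (h : ζ.IsStraightening ψ P) (hasy : ζ.IsAsystatic) {x : M}
    (hx : x ∈ ψ.source) {T : TangentSpace 𝓘(ℝ, E) x →L[ℝ] TangentSpace 𝓘(ℝ, E) x}
    (hT : LinearMap.IsProj (ζ.vertical x) (T : _ →ₗ[ℝ] TangentSpace 𝓘(ℝ, E) x))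
    (hker : LinearMap.ker (T : _ →ₗ[ℝ] TangentSpace 𝓘(ℝ, E) x) = ζ.isotropyNullspace x)
    (v : TangentSpace 𝓘(ℝ, E) x) :
    mfderiv 𝓘(ℝ, E) 𝓘(ℝ, F) ψ x (T v) = P (mfderiv 𝓘(ℝ, E) 𝓘(ℝ, F) ψ x v) := by
  have h1 : T v ∈ ζ.vertical x := hT.map_mem v
  have h2 : v - T v ∈ ζ.isotropyNullspace x := by
    rw [← hker, LinearMap.mem_ker, map_sub, sub_eq_zero]
    exact (hT.map_id _ h1).symm
  rw [h.mem_vertical_iff hx] at h1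
  rw [h.mem_isotropyNullspace_iff hasy hx] at h2
  rw [← h1]
  have h3 : mfderiv 𝓘(ℝ, E) 𝓘(ℝ, F) ψ x (v - T v) =
    mfderiv 𝓘(ℝ, E) 𝓘(ℝ, F) ψ x v - mfderiv 𝓘(ℝ, E) 𝓘(ℝ, F) ψ x (T v) := map_sub _ _ _
  rw [h3] at h2
  exact (sub_eq_zero.1 ((map_sub P _ _).symm.trans h2)).symm

/-- The witness is `P` conjugated by the derivative of the chart. -/
theorem exists_isProj (h : ζ.IsStraightening ψ P) (hasy : ζ.IsAsystatic) {x : M}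
    (hx : x ∈ ψ.source) :
    ∃ T : TangentSpace 𝓘(ℝ, E) x →L[ℝ] TangentSpace 𝓘(ℝ, E) x,
      LinearMap.IsProj (ζ.vertical x) (T : _ →ₗ[ℝ] TangentSpace 𝓘(ℝ, E) x) ∧
      LinearMap.ker (T : _ →ₗ[ℝ] TangentSpace 𝓘(ℝ, E) x) = ζ.isotropyNullspace x := by
  let d : E →L[ℝ] F := mfderiv 𝓘(ℝ, E) 𝓘(ℝ, F) ψ x
  let d' : F →L[ℝ] E := mfderiv 𝓘(ℝ, F) 𝓘(ℝ, E) ψ.symm (ψ x)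
  have hd'd (v : E) : d' (d v) = v := ψ.mfderiv_symm_mfderiv hx v
  have hdd' (w : F) : d (d' w) = w := ψ.mfderiv_mfderiv_symm hx w
  refine ⟨d'.comp (P.comp d), ⟨fun v => ?_, fun v hv => ?_⟩, ?_⟩
  · refine (h.mem_vertical_iff hx _).2 ?_
    change P (d (d' (P (d v)))) = d (d' (P (d v)))
    rw [hdd', h.idem]
  · have hv' : P (d v) = d v := (h.mem_vertical_iff hx v).1 hv
    exact (congrArg d' hv').trans (hd'd v)
  · ext v
    rw [h.mem_isotropyNullspace_iff hasy hx, LinearMap.mem_ker]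
    change d' (P (d v)) = 0 ↔ P (d v) = 0
    refine ⟨fun h0 => ?_, fun h0 => by rw [h0, map_zero]⟩
    rw [← hdd' (P (d v)), h0, map_zero]

/-- In the chart, `[ζ_X, K V]` and `K [ζ_X, V]` share the term that differentiates `V`. The other
terms are `-D P V` and `-P D V`, with `D` the derivative of `ζ_X`, and both equal `-D V`. -/
theorem lieDerivEndo_eq_zero (h : ζ.IsStraightening ψ P)
    {K : Π x : M, TangentSpace 𝓘(ℝ, E) x →L[ℝ] TangentSpace 𝓘(ℝ, E) x}
    (hK : SmoothEndo K) (hKP : IsConstantInChart K ψ P) {x : M} (hx : x ∈ ψ.source) (X : 𝔤)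
    {V : Π x : M, TangentSpace 𝓘(ℝ, E) x} (hV : SmoothFieldAt V x) :
    lieDerivEndo (ζ.field X) K V x = 0 := by
  have : CompleteSpace E := FiniteDimensional.complete ℝ E
  rw [lieDerivEndo, sub_eq_zero]
  have h1 := hKP.mfderiv_mlieBracket_right hK hx (ζ.smooth X x) hV
  have h2 := hKP x hx (mlieBracket 𝓘(ℝ, E) (ζ.field X) V x)
  rw [ψ.mfderiv_mlieBracket hx (ζ.smooth X x) hV, lieBracket, map_sub, h.proj_fderiv hx] at h2
  rw [h.fderiv_apply_proj hx, ← h2] at h1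
  have h3 := ψ.mfderiv_symm_mfderiv hx
    (mlieBracket 𝓘(ℝ, E) (ζ.field X) (fun y => K y (V y)) x)
  rw [h1, ψ.mfderiv_symm_mfderiv hx] at h3
  exact h3.symm

end IsStraightening

/-- If `V(x)` lies in the kernel, invariance gives `Φ (ρ(X) V(x)) = ρ(X) (Φ V(x)) = 0`. As `ρ(X)
V(x)` is vertical, `Φ` fixes it, so it vanishes. Equality follows because the kernel is a complement
of the vertical space, which meets the nullspace trivially. -/
theorem ker_eq_isotropyNullspace (hasy : ζ.IsAsystatic)
    {Φ : Π x : M, TangentSpace 𝓘(ℝ, E) x →L[ℝ] TangentSpace 𝓘(ℝ, E) x}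
    (hΦ : ζ.IsPrincipalConnection Φ) (x : M)
    (hvert : ∀ (X : ζ.isotropy x) (v : TangentSpace 𝓘(ℝ, E) x),
      ζ.isotropyRep x X v ∈ ζ.vertical x) :
    LinearMap.ker (Φ x : _ →ₗ[ℝ] TangentSpace 𝓘(ℝ, E) x) = ζ.isotropyNullspace x := by
  have hle : LinearMap.ker (Φ x : _ →ₗ[ℝ] TangentSpace 𝓘(ℝ, E) x) ≤ ζ.isotropyNullspace x := by
    intro v hv
    rw [isotropyNullspace, Submodule.mem_iInf]
    intro X
    obtain ⟨V, hV, rfl⟩ := exists_smoothFieldAt x v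
    have h0 : Φ x (V x) = 0 := hv
    have h1 := hΦ.invariant X x V hV
    have h2 := ζ.isotropyRep_apply x X (hΦ.smooth.smoothFieldAt hV)
    rw [h0, map_zero] at h2
    rw [lieDerivEndo, ← h2, zero_sub, neg_eq_zero, ← ζ.isotropyRep_apply x X hV] at h1
    rw [LinearMap.mem_ker, ← (hΦ.isProj x).map_id _ (hvert X (V x))]
    exact h1
  refine le_antisymm hle fun v hv => ?_
  have h1 : Φ x v ∈ ζ.vertical x := (hΦ.isProj x).map_mem v
  have h2 : v - Φ x v ∈ ζ.isotropyNullspace x := by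
    apply hle
    rw [LinearMap.mem_ker, map_sub, sub_eq_zero]
    exact ((hΦ.isProj x).map_id _ h1).symm
  have h3 := sub_mem hv h2
  rw [sub_sub_cancel] at h3
  exact Submodule.disjoint_def.1 (hasy.disjoint x) _ h1 h3

end LieAlgebraAction

/-! ### Straightening charts from local triviality. -/

section ExtendedChart

/-- The extended chart at a point of a boundaryless manifold, as a partial diffeomorphism
onto an open subset of the model vector space. -/
noncomputable def extChartPartialDiffeomorph {E : Type*} [NormedAddCommGroup E] [NormedSpace ℝ E]
    {H : Type*} [TopologicalSpace H] (I : ModelWithCorners ℝ E H) [I.Boundaryless]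
    {M : Type*} [TopologicalSpace M] [ChartedSpace H M] [IsManifold I ∞ M] (x : M) :
    PartialDiffeomorph I 𝓘(ℝ, E) M E ∞ where
  toPartialEquiv := extChartAt I x
  open_source := isOpen_extChartAt_source x
  open_target := isOpen_extChartAt_target x
  contMDiffOn_toFun := by
    have h : ContMDiffOn I 𝓘(ℝ, E) ∞ (extChartAt I x) (chartAt H x).source :=
      contMDiffOn_extChartAt
    rwa [← extChartAt_source I x] at h
  contMDiffOn_invFun := contMDiffOn_extChartAt_symm x

end ExtendedChart

namespace LieAlgebraAction

open Filter Topology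

variable {𝔤 : Type*} [LieRing 𝔤] [LieAlgebra ℝ 𝔤]
  {E : Type*} [NormedAddCommGroup E] [NormedSpace ℝ E]
  {M : Type*} [TopologicalSpace M] [ChartedSpace E M] [IsManifold 𝓘(ℝ, E) ∞ M]

/-- The projection of a product of two vector spaces onto the second factor. -/
noncomputable def sndProj (F₁ F₂ : Type*) [NormedAddCommGroup F₁] [NormedSpace ℝ F₁]
    [NormedAddCommGroup F₂] [NormedSpace ℝ F₂] : F₁ × F₂ →L[ℝ] F₁ × F₂ :=
  (ContinuousLinearMap.inr ℝ F₁ F₂).comp (ContinuousLinearMap.snd ℝ F₁ F₂)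

/-- The bundle chart is followed by a product of charts of the base and of the fibre. By
equivariance a fundamental field becomes `(0, local expression of η_X)`, a function of the fibre
coordinate alone. -/
theorem IsBundleChart.exists_isStraightening {ζ : LieAlgebraAction 𝔤 E M} {n k : ℕ}
    {N : Type*} [TopologicalSpace N] [ChartedSpace (EuclideanSpace ℝ (Fin n)) N]
    [IsManifold (𝓡 n) ∞ N]
    {S : Type*} [TopologicalSpace S] [ChartedSpace (EuclideanSpace ℝ (Fin k)) S]
    [IsManifold (𝓡 k) ∞ S]
    {η : LieAlgebraAction 𝔤 (EuclideanSpace ℝ (Fin k)) S} (hη : η.IsTransitive)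
    {p : M → N} {U : Set N}
    {φ : PartialDiffeomorph 𝓘(ℝ, E) ((𝓡 n).prod (𝓡 k)) M (N × S) ∞}
    (hφ : ζ.IsBundleChart η p U φ) {x : M} (hx : p x ∈ U) :
    ∃ ψ : PartialDiffeomorph 𝓘(ℝ, E)
        𝓘(ℝ, EuclideanSpace ℝ (Fin n) × EuclideanSpace ℝ (Fin k)) M
        (EuclideanSpace ℝ (Fin n) × EuclideanSpace ℝ (Fin k)) ∞,
      x ∈ ψ.source ∧ ζ.IsStraightening ψ (sndProj _ _) := by
  let a : N := (φ x).1
  let s : S := (φ x).2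
  let χ := extChartPartialDiffeomorph ((𝓡 n).prod (𝓡 k)) (φ x)
  let ψ := φ.trans χ
  let σ : PartialDiffeomorph (𝓡 k) (𝓡 k) S (EuclideanSpace ℝ (Fin k)) ∞ :=
    extChartPartialDiffeomorph (𝓡 k) s
  have hxs : x ∈ φ.source := by rw [hφ.source_eq]; exact hx
  have hχ : χ.toPartialEquiv = (extChartAt (𝓡 n) a).prod (extChartAt (𝓡 k) s) :=
    extChartAt_prod (φ x)
  have hsource (y : M) (hy : y ∈ ψ.source) : y ∈ φ.source ∧ φ y ∈ χ.source := hy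
  have key (X : 𝔤) (y : M) (hy : y ∈ ψ.source) :
      ψ.transport (ζ.field X) (ψ y) = (0, σ.transport (η.field X) (ψ y).2) := by
    obtain ⟨hy1, hy2⟩ := hsource y hy
    have hy3 : φ y ∈ (extChartAt (𝓡 n) a).source ×ˢ (extChartAt (𝓡 k) s).source := by
      have : φ y ∈ χ.toPartialEquiv.source := hy2
      rwa [hχ, PartialEquiv.prod_source] at this
    have hσ : (φ y).2 ∈ σ.source := hy3.2
    have hN : MDifferentiableAt (𝓡 n) (𝓡 n) (extChartAt (𝓡 n) a) (φ y).1 :=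
      mdifferentiableAt_extChartAt (by simpa using hy3.1)
    have hS : MDifferentiableAt (𝓡 k) (𝓡 k) σ (φ y).2 := σ.mdifferentiableAt (by simp) hσ
    have hψ2 : (ψ y).2 = σ (φ y).2 := by
      change (χ.toPartialEquiv (φ y)).2 = _
      rw [hχ]; rfl
    rw [hψ2, ψ.transport_apply _ hy, σ.transport_apply _ hσ]
    have hψy : MDifferentiableAt 𝓘(ℝ, E)
        𝓘(ℝ, EuclideanSpace ℝ (Fin n) × EuclideanSpace ℝ (Fin k)) ψ y :=
      ψ.mdifferentiableAt (by simp) hy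
    have hφy := φ.mdifferentiableAt (by simp) hy1
    have heq := hφ.equivariant X y (by rw [← hφ.source_eq]; exact hy1)
    -- The two components of `ψ` are differentiated separately by the chain rule, since equivariance
    -- of `φ` prescribes the base and fibre components separately.
    have e1 : ContinuousLinearMap.fst ℝ (EuclideanSpace ℝ (Fin n)) (EuclideanSpace ℝ (Fin k)) ∘ ψ =
        extChartAt (𝓡 n) a ∘ (Prod.fst ∘ φ) := by
      funext y
      change (χ.toPartialEquiv (φ y)).1 = _
      rw [hχ]; rfl
    have e2 : ContinuousLinearMap.snd ℝ (EuclideanSpace ℝ (Fin n)) (EuclideanSpace ℝ (Fin k)) ∘ ψ =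
        σ ∘ (Prod.snd ∘ φ) := by
      funext y
      change (χ.toPartialEquiv (φ y)).2 = _
      rw [hχ]; rfl
    have d1 := mfderiv_comp y (ContinuousLinearMap.mdifferentiableAt (ContinuousLinearMap.fst ℝ
      (EuclideanSpace ℝ (Fin n)) (EuclideanSpace ℝ (Fin k)))) hψy
    have d2 := mfderiv_comp y (ContinuousLinearMap.mdifferentiableAt (ContinuousLinearMap.snd ℝ
      (EuclideanSpace ℝ (Fin n)) (EuclideanSpace ℝ (Fin k)))) hψy
    rw [ContinuousLinearMap.mfderiv_eq, e1, mfderiv_comp y (I' := 𝓡 n) hN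
      (mdifferentiableAt_fst.comp y hφy), mfderiv_comp y mdifferentiableAt_fst hφy,
      mfderiv_fst] at d1
    rw [ContinuousLinearMap.mfderiv_eq, e2, mfderiv_comp y (I' := 𝓡 k) hS
      (mdifferentiableAt_snd.comp y hφy), mfderiv_comp y mdifferentiableAt_snd hφy,
      mfderiv_snd] at d2
    have c1 := congrArg (fun A => A (ζ.field X y)) d1
    have c2 := congrArg (fun A => A (ζ.field X y)) d2
    refine Prod.ext (c1.symm.trans ?_) (c2.symm.trans ?_)
    · refine (congrArg (fun u : EuclideanSpace ℝ (Fin n) × EuclideanSpace ℝ (Fin k) =>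
        mfderiv (𝓡 n) (𝓡 n) (extChartAt (𝓡 n) a) (φ y).1 u.1) heq).trans ?_
      exact map_zero _
    · exact congrArg (fun u : EuclideanSpace ℝ (Fin n) × EuclideanSpace ℝ (Fin k) =>
        mfderiv (𝓡 k) (𝓡 k) σ (φ y).2 u.2) heq
  have htarget (z) (hz : z ∈ ψ.target) : ∃ y ∈ ψ.source, ψ y = z :=
    ⟨ψ.symm z, ψ.map_target hz, ψ.apply_symm_apply hz⟩
  have key' (X : 𝔤) (z) (hz : z ∈ ψ.target) :
      ψ.transport (ζ.field X) z = (0, σ.transport (η.field X) z.2) := by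
    obtain ⟨y, hy, rfl⟩ := htarget z hz
    exact key X y hy
  refine ⟨ψ, ⟨hxs, mem_extChartAt_source (I := (𝓡 n).prod (𝓡 k)) (φ x)⟩, fun w => rfl,
    fun X z hz => ?_, fun X z hz => ?_, fun z hz w => ?_⟩
  · rw [key' X z hz]; rfl
  -- The base component of `z + P (z' - z)` is that of `z`, its fibre component that of `z'`. The
  -- local formula applies at both points once both lie in the target, which holds for `z'` close to
  -- `z`.
  · have hcont : ContinuousAt (fun z' => z + sndProj _ _ (z' - z)) z := by fun_prop
    have hz2 : z + sndProj _ _ (z - z) ∈ ψ.target := by simpa using hz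
    filter_upwards [ψ.open_target.mem_nhds hz,
      hcont.preimage_mem_nhds (ψ.open_target.mem_nhds hz2)] with z' hz' hz''
    rw [key' X z' hz', key' X _ hz'']
    have : (z + sndProj _ _ (z' - z)).2 = z'.2 := by simp [sndProj]
    rw [this]
  · have hz2 : z.2 ∈ σ.target := by
      have : z ∈ χ.toPartialEquiv.target := hz.1
      rw [hχ, PartialEquiv.prod_target] at this
      exact this.2
    -- Transitivity on the fibre realizes the tangent vector with coordinates `w.2`.
    obtain ⟨X, hX⟩ := hη (σ.symm z.2) (mfderiv (𝓡 k) (𝓡 k) σ.symm z.2 w.2)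
    refine ⟨X, ?_⟩
    have hy : σ.symm z.2 ∈ σ.source := σ.map_target hz2
    have h1 := σ.transport_apply (η.field X) hy
    have h2 := σ.mfderiv_mfderiv_symm hy w.2
    rw [σ.apply_symm_apply hz2] at h1 h2
    rw [key' X z hz, h1]
    change _ = ((0 : EuclideanSpace ℝ (Fin n)), w.2)
    rw [← h2, ← hX]
    rfl

end LieAlgebraAction

namespace LieAlgebraAction

variable {𝔤 : Type*} [LieRing 𝔤] [LieAlgebra ℝ 𝔤]
  {E : Type*} [NormedAddCommGroup E] [NormedSpace ℝ E]
  {M : Type*} [TopologicalSpace M] [ChartedSpace E M] [IsManifold 𝓘(ℝ, E) ∞ M]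

theorem IsLocallyTrivial.exists_isStraightening {ζ : LieAlgebraAction 𝔤 E M}
    (hloc : IsLocallyTrivial.{v, w} ζ) :
    ∃ n k : ℕ, ∀ x : M, ∃ (ψ : PartialDiffeomorph 𝓘(ℝ, E)
        𝓘(ℝ, EuclideanSpace ℝ (Fin n) × EuclideanSpace ℝ (Fin k)) M
        (EuclideanSpace ℝ (Fin n) × EuclideanSpace ℝ (Fin k)) ∞),
      x ∈ ψ.source ∧ ζ.IsStraightening ψ (sndProj _ _) := by
  obtain ⟨n, k, N, _, _, _, _, S, _, _, _, _, _, η, p, hη, -, -, hp⟩ := hloc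
  refine ⟨n, k, fun x => ?_⟩
  obtain ⟨U, hxU, φ, hφ⟩ := hp (p x)
  exact hφ.exists_isStraightening hη hxU

end LieAlgebraAction

/-! ### Existence, uniqueness and flatness. -/

theorem proposition6p2
    {𝔤 : Type*} [LieRing 𝔤] [LieAlgebra ℝ 𝔤] [FiniteDimensional ℝ 𝔤]
    {E : Type*} [NormedAddCommGroup E] [NormedSpace ℝ E] [FiniteDimensional ℝ E]
    {M : Type*} [TopologicalSpace M] [T2Space M] [ChartedSpace E M] [IsManifold 𝓘(ℝ, E) ∞ M]
    (ζ : LieAlgebraAction 𝔤 E M)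
    (hloc : LieAlgebraAction.IsLocallyTrivial.{v, w} ζ)
    (hasy : ζ.IsAsystatic) :
    (∃! Φ : (Π x : M, TangentSpace 𝓘(ℝ, E) x →L[ℝ] TangentSpace 𝓘(ℝ, E) x),
      ζ.IsPrincipalConnection Φ) ∧
    ∀ Φ : (Π x : M, TangentSpace 𝓘(ℝ, E) x →L[ℝ] TangentSpace 𝓘(ℝ, E) x),
      ζ.IsPrincipalConnection Φ →
        IsFlatConnection Φ ∧
        ∀ x : M, LinearMap.ker (Φ x : _ →ₗ[ℝ] TangentSpace 𝓘(ℝ, E) x) = ζ.isotropyNullspace x := by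
  have : CompleteSpace E := FiniteDimensional.complete ℝ E
  obtain ⟨n, k, hstr⟩ := hloc.exists_isStraightening
  have hker (Φ : Π x : M, TangentSpace 𝓘(ℝ, E) x →L[ℝ] TangentSpace 𝓘(ℝ, E) x)
      (hΦ : ζ.IsPrincipalConnection Φ) (x : M) :
      LinearMap.ker (Φ x : _ →ₗ[ℝ] TangentSpace 𝓘(ℝ, E) x) = ζ.isotropyNullspace x := by
    obtain ⟨ψ, hx, hψ⟩ := hstr x
    exact LieAlgebraAction.ker_eq_isotropyNullspace hasy hΦ x (hψ.isotropyRep_mem_vertical hx)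
  have hex (x : M) : ∃ T : TangentSpace 𝓘(ℝ, E) x →L[ℝ] TangentSpace 𝓘(ℝ, E) x,
      LinearMap.IsProj (ζ.vertical x) (T : _ →ₗ[ℝ] TangentSpace 𝓘(ℝ, E) x) ∧
      LinearMap.ker (T : _ →ₗ[ℝ] TangentSpace 𝓘(ℝ, E) x) = ζ.isotropyNullspace x := by
    obtain ⟨ψ, hx, hψ⟩ := hstr x
    exact hψ.exists_isProj hasy hx
  -- The choice is made point by point, but range and kernel leave no freedom; smoothness follows
  -- because the result is constant in every straightening chart.
  choose Φ hproj hkerΦ using hex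
  have hsmooth : SmoothEndo Φ := by
    intro a
    obtain ⟨ψ, hx, hψ⟩ := hstr a.proj
    exact IsConstantInChart.contMDiffAt (ψ := ψ)
      (fun y hy v => hψ.mfderiv_apply_of_isProj hasy hy (hproj y) (hkerΦ y) v) a hx
  have hΦ : ζ.IsPrincipalConnection Φ := by
    refine ⟨⟨hsmooth, hproj⟩, fun X x V hV => ?_⟩
    obtain ⟨ψ, hx, hψ⟩ := hstr x
    exact hψ.lieDerivEndo_eq_zero hsmooth
      (fun y hy v => hψ.mfderiv_apply_of_isProj hasy hy (hproj y) (hkerΦ y) v) hx X hV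
  refine ⟨⟨Φ, hΦ, fun Φ' hΦ' => funext fun x => ?_⟩,
    fun Φ' hΦ' => ⟨fun x V W hV hW => ?_, hker Φ' hΦ'⟩⟩
  · exact LieAlgebraAction.eq_of_isProj_of_ker_eq (hΦ'.isProj x) (hproj x)
      ((hker Φ' hΦ' x).trans (hkerΦ x).symm)
  · obtain ⟨ψ, hx, hψ⟩ := hstr x
    exact IsConstantInChart.connectionCurvature_eq_zero
      (fun y hy v => hψ.mfderiv_apply_of_isProj hasy hy (hΦ'.isProj y) (hker Φ' hΦ' y) v)
      hΦ'.smooth hψ.idem hx hV hW
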